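/- Let $A$ be a finite linearly ordered alphabet; order infinite words over $A$ lexicographically and let $\sigma$ be the shift $\sigma(u[0]u[1]u[2]\cdots)=u[1]u[2]\cdots$. Let $k\ge 2$ and let $\varphi:A^*\to A^*$ be a $k$-uniform morphism ($|\varphi(a)|=k$ for every letter $a$) which is primitive (some positive power of the matrix whose $(i,j)$ entry is the number of occurrences of $i$ in $\varphi(j)$ has only positive entries). Let $w=\varphi(w)$ be an infinite fixed point of $\varphi$ and let $L$ be the closure of $\{\sigma^n(w):n\ge 0\}$. Assume that * $\varphi$ is order-preserving on $L$: for $u,v\in L$, $u<v$ if and only if $\varphi(u)<\varphi(v)$; * $L$ is separable: every $u\in L$ can be written as $u=\sigma^p(\varphi(u'))$ with $u'\in L$ and $0\le p<|\varphi(u'[0])|$ for exactly one pair $(u',p)$ (the pair $(u'[0],p)$ is then called the type of $u$), and there is a strict total order on the set of all pairs $(a,p)$, $a\in A$, $0\le p<|\varphi(a)|$, such that $u<v$ whenever $u,v\in L$ and the type of $u$ is less than the type of $v$. Let $\mu$ be the shift-invariant probability measure on $L$, put $\nu(v)=\mu(\{u\in L: u\le v\})$ for $v\in L$, and let $\nu_w=(\nu_w[n])_{n\ge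 0}$ be the real sequence $\nu_w[n]=\nu(\sigma^n(w))$. Then $\nu_w$ is $k$-regular: for every Noetherian subring $R$ of $\mathbb R$ with $1/k\in R$ (for example $R=\mathbb R$, $\mathbb Q$ or $\mathbb Z[1/k]$), the $R$-module generated by the $k$-kernel $\{(\nu_w[k^e n+j])_{n\ge 0}: e\ge 0,\ 0\le j<k^e\}$ is finitely generated. Moreover, let $\theta$ be the Perron-Frobenius eigenvalue of the matrix of $\varphi$ and fix an order of the types as above. For a letter $a$ let $\mu_a$ be the measure of $\{u\in L:u[0]=a\}$ and $x_1=\sum_{b<a}\mu_b$, $x_2=x_1+\mu_a$; for a type $(a,p)$ let $y_1=\sum_{(b,q)<(a,p)}\mu_b/\theta$, $y_2=y_1+\mu_a/\theta$; let $f_{a,p}(x)=\frac{y_2-y_1}{x_2-x_1}(x-x_1)+y_1$ and $C_{a,p}=y_1-x_1/\theta$. Then $\theta=k$, $f_{a,p}(x)=x/\theta+C_{a,p}$ for all types $(a,p)$ and all real $x$, and $\nu_w[kn+p]=\nu_w[n]/k+C_{w[n],p}$ for all $n\ge 0$ and $0\le p<k$. -/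

import Mathlib

namespace MorphicWord

/-! Infinite words over an alphabet `A` are functions `ℕ → A`; a morphism `φ` of the free monoid of
finite words over `A` is given by its values `φ : A → List A` on letters. -/

/-- The shift `σ`, which erases the first letter. -/
def shift {A : Type*} (u : ℕ → A) : ℕ → A := fun n => u (n + 1)

/-- The subshift generated by `w`: the closure of the orbit of `w` under the shift. -/
def subshift {A : Type*} [TopologicalSpace A] (w : ℕ → A) : Set (ℕ → A) :=
  closure (Set.range fun n : ℕ => shift^[n] w)

/-- The image `φ(u) = φ(u 0) φ(u 1) ⋯` of an infinite word under a morphism. If all the words `φ a`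
are nonempty, then the prefix `φ(u 0) ⋯ φ(u n)` has more than `n` letters, so that its letter number
`n` is the letter number `n` of `φ(u)` and the default value `u 0` is not used. -/
def morphImage {A : Type*} (φ : A → List A) (u : ℕ → A) : ℕ → A := fun n =>
  ((List.range (n + 1)).flatMap fun i => φ (u i)).getD n (u 0)

/-- The matrix of a morphism: the entry `(i, j)` is the number of occurrences of `i` in `φ j`. -/
def incidenceMatrix {A : Type*} [DecidableEq A] (φ : A → List A) : Matrix A A ℝ :=
  Matrix.of fun i j => ((φ j).count i : ℝ)

/-- The morphism `φ` is primitive: some positive power of its matrix has positive entries only. -/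
def IsPrimitive {A : Type*} [Fintype A] [DecidableEq A] (φ : A → List A) : Prop :=
  (incidenceMatrix φ).IsPrimitive

/-- `θ` is the dominant (Perron-Frobenius) eigenvalue of `M`: a positive eigenvalue which is greater
than the absolute value of every other complex eigenvalue. -/
def IsPerronEigenvalue {A : Type*} [Fintype A] [DecidableEq A] (M : Matrix A A ℝ) (θ : ℝ) : Prop :=
  0 < θ ∧
  Module.End.HasEigenvalue (Matrix.toLin' (M.map (fun x : ℝ => (x : ℂ)))) (θ : ℂ) ∧
  ∀ z : ℂ, Module.End.HasEigenvalue (Matrix.toLin' (M.map (fun x : ℝ => (x : ℂ)))) z →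
    z ≠ (θ : ℂ) → ‖z‖ < θ

/-- The morphism `φ` is `k`-uniform: the images of all letters have length `k`. -/
def IsUniform {A : Type*} (φ : A → List A) (k : ℕ) : Prop := ∀ a, (φ a).length = k

/-- `φ` preserves the lexicographic order on the words of `L`. -/
def OrderPreservingOn {A : Type*} [LinearOrder A] (φ : A → List A) (L : Set (ℕ → A)) : Prop :=
  ∀ u ∈ L, ∀ v ∈ L, toLex u < toLex v ↔ toLex (morphImage φ u) < toLex (morphImage φ v)

/-- `u = σ^p (φ u')` with `u' ∈ L` and `0 ≤ p < |φ (u' 0)|`. -/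
def IsDesubstitution {A : Type*} (φ : A → List A) (L : Set (ℕ → A)) (u u' : ℕ → A) (p : ℕ) :
    Prop :=
  u' ∈ L ∧ p < (φ (u' 0)).length ∧ u = shift^[p] (morphImage φ u')

/-- `L` is typable: each of its elements is `σ^p (φ u')` for exactly one pair `(u', p)`. -/
def Typable {A : Type*} (φ : A → List A) (L : Set (ℕ → A)) : Prop :=
  ∀ u ∈ L, ∃! q : (ℕ → A) × ℕ, IsDesubstitution φ L u q.1 q.2

/-- The possible types: the pairs `(a, p)` with `a` a letter and `0 ≤ p < |φ a|`. -/
abbrev WordType {A : Type*} (φ : A → List A) : Type _ := Σ a : A, Fin (φ a).length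

/-- In a typable subshift: the type of `u` is `t = (a, p)`. -/
def HasType {A : Type*} (φ : A → List A) (L : Set (ℕ → A)) (u : ℕ → A) (t : WordType φ) : Prop :=
  ∃ u', IsDesubstitution φ L u u' t.2 ∧ u' 0 = t.1

/-- `r` is a strict total order on the types such that words of `L` of different types are in the
lexicographic order whenever their types are in the order `r`. -/
def IsTypeOrder {A : Type*} [LinearOrder A] (φ : A → List A) (L : Set (ℕ → A))
    (r : WordType φ → WordType φ → Prop) : Prop :=
  IsStrictTotalOrder (WordType φ) r ∧
  ∀ u ∈ L, ∀ v ∈ L, ∀ s t, HasType φ L u s → HasType φ L v t → r s t → toLex u < toLex v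

/-- `L` is separable: it is typable and the types can be ordered compatibly with the words. -/
def Separable {A : Type*} [LinearOrder A] (φ : A → List A) (L : Set (ℕ → A)) : Prop :=
  Typable φ L ∧ ∃ r, IsTypeOrder φ L r

/-- `μ` is a shift-invariant probability measure on the subshift `L` (seen as a measure on the space
of all infinite words that is carried by `L`). -/
def IsInvariantMeasureOn {A : Type*} [MeasurableSpace A] (μ : MeasureTheory.Measure (ℕ → A))
    (L : Set (ℕ → A)) : Prop :=
  MeasureTheory.IsProbabilityMeasure μ ∧ μ Lᶜ = 0 ∧ MeasureTheory.MeasurePreserving shift μ μ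

/-- `ν(v) = μ([w_min, v])`: the measure of the set of elements of `L` which are lexicographically
at most `v` (all of them are at least the minimal element `w_min` of `L`). -/
noncomputable def nu {A : Type*} [LinearOrder A] [MeasurableSpace A]
    (μ : MeasureTheory.Measure (ℕ → A)) (L : Set (ℕ → A)) (v : ℕ → A) : ℝ :=
  μ.real {u | u ∈ L ∧ toLex u ≤ toLex v}

/-- The sequence `ν_w[n] = ν(σ^n w)`, where `ν` is taken on the subshift generated by `w`. -/
noncomputable def nuSeq {A : Type*} [LinearOrder A] [TopologicalSpace A] [MeasurableSpace A]
    (μ : MeasureTheory.Measure (ℕ → A)) (w : ℕ → A) : ℕ → ℝ :=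
  fun n => nu μ (subshift w) (shift^[n] w)

/-- The measure (frequency) `μ_a` of the cylinder `[a]` of a letter in `L`. -/
noncomputable def letterFreq {A : Type*} [MeasurableSpace A] (μ : MeasureTheory.Measure (ℕ → A))
    (L : Set (ℕ → A)) (a : A) : ℝ :=
  μ.real {u | u ∈ L ∧ u 0 = a}

open Classical in
/-- The lower end of the interval `I_a`, which is the sum of `μ_b` over the letters `b < a`. -/
noncomputable def lowerI {A : Type*} [Fintype A] [LinearOrder A] [MeasurableSpace A]
    (μ : MeasureTheory.Measure (ℕ → A)) (L : Set (ℕ → A)) (a : A) : ℝ :=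
  ∑ b : A with b < a, letterFreq μ L b

open Classical in
/-- The lower end of the interval `J_t` of a type `t`: the sum of the lengths `μ_b / θ` over the
types `(b, q)` which are less than `t` in the order `r`. -/
noncomputable def lowerJ {A : Type*} [Fintype A] [LinearOrder A] [MeasurableSpace A]
    (μ : MeasureTheory.Measure (ℕ → A)) (L : Set (ℕ → A)) (φ : A → List A) (θ : ℝ)
    (r : WordType φ → WordType φ → Prop) (t : WordType φ) : ℝ :=
  ∑ s : WordType φ with r s t, letterFreq μ L s.1 / θ

/-- The affine map `f_{a,p}` which sends `I_a = [x₁, x₂]` onto `J_{a,p} = [y₁, y₂]`, where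
`x₂ = x₁ + μ_a` and `y₂ = y₁ + μ_a / θ`. -/
noncomputable def intervalMap {A : Type*} [Fintype A] [LinearOrder A] [MeasurableSpace A]
    (μ : MeasureTheory.Measure (ℕ → A)) (L : Set (ℕ → A)) (φ : A → List A) (θ : ℝ)
    (r : WordType φ → WordType φ → Prop) (t : WordType φ) (x : ℝ) : ℝ :=
  let x₁ := lowerI μ L t.1
  let x₂ := x₁ + letterFreq μ L t.1
  let y₁ := lowerJ μ L φ θ r t
  let y₂ := y₁ + letterFreq μ L t.1 / θ
  (y₂ - y₁) / (x₂ - x₁) * (x - x₁) + y₁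

/-- The constant `C_{a,p} = y₁ - x₁ / θ`. -/
noncomputable def intervalConst {A : Type*} [Fintype A] [LinearOrder A] [MeasurableSpace A]
    (μ : MeasureTheory.Measure (ℕ → A)) (L : Set (ℕ → A)) (φ : A → List A) (θ : ℝ)
    (r : WordType φ → WordType φ → Prop) (t : WordType φ) : ℝ :=
  lowerJ μ L φ θ r t - lowerI μ L t.1 / θ

/-- The `k`-kernel of a sequence: the subsequences `(s (k^e n + j))_n` with `e ≥ 0`, `0 ≤ j < k^e`. -/
def kernel {S : Type*} (k : ℕ) (s : ℕ → S) : Set (ℕ → S) :=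
  {t | ∃ e j : ℕ, j < k ^ e ∧ t = fun n => s (k ^ e * n + j)}

/-- `s` is `(R, k)`-regular: the `R`-module generated by its `k`-kernel is finitely generated. -/
def IsRegularSeq (R : Type*) {S : Type*} [CommRing R] [CommRing S] [Algebra R S] (k : ℕ)
    (s : ℕ → S) : Prop :=
  (Submodule.span R (kernel k s)).FG

end MorphicWord

/-! Every `u ∈ L` is `σ^p (φ u')` for one pair, so `L` splits into a tower of `k` levels according
to the offset `p`, and the shift carries each level but the last to the next. Hence all levels have
equal mass. If `μ'` denotes the image of `μ` under the map `root : u ↦ u'`, the words of type `(a,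
p)` have mass `μ'_a / k`. As the order on `L` goes by type first and then, inside a type, by `u'`,
it follows that `ν(v)` is the mass of the smaller types plus `1/k` times the part of `ν'(v')` inside
the cylinder of `v' 0` (`nu_eq_lowerJ_add`).

It remains to replace `μ'` by `μ`. Unique ergodicity is not invoked: `μ'` is again an invariant
probability measure on `L`, and two such measures are compared by contraction. Letter frequencies
satisfy `μ_• = M μ'_• / k`, and a positive power of `M / k` contracts zero-sum vectors
(`letterFreq_unique`); then the difference of two functions `ν` shrinks by `1/k` at each
desubstitution (`nu_unique`). Thus `ν(v) = ν(v') / k + C`, with `C` determined by the type of `v`.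

For `v = σ^(kn+p) w` the root is `σ^n w`, which gives the recurrence. Regularity follows: `ν_w`
together with finitely many multiples of letter indicators of `w` spans a module stable under `n ↦
kn + p`. Finally `θ = k` because all columns of `M` sum to `k`. -/

namespace MorphicWord

open MeasureTheory

/-! ### Uniform morphisms, lexicographic order and desubstitution -/

section Words

variable {A : Type*} {φ : A → List A} {k : ℕ} {L : Set (ℕ → A)}

theorem shift_iterate_apply (p : ℕ) (u : ℕ → A) (n : ℕ) : shift^[p] u n = u (n + p) := by
  induction p generalizing u with
  | zero => rfl
  | succ p ih =>
    rw [Function.iterate_succ_apply, ih, shift]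
    congr 1

theorem length_flatMap_range (hφ : IsUniform φ k) (u : ℕ → A) (n : ℕ) :
    ((List.range n).flatMap fun i => φ (u i)).length = k * n := by
  induction n with
  | zero => simp
  | succ n ih => rw [List.range_succ, List.flatMap_append, List.length_append, ih]; simp [hφ _]; ring

theorem getElem?_flatMap_range (hφ : IsUniform φ k) (u : ℕ → A) {n m p : ℕ} (hp : p < k)
    (hm : m < n) :
    ((List.range n).flatMap fun i => φ (u i))[k * m + p]? = (φ (u m))[p]? := by
  induction n with
  | zero => omega
  | succ n ih =>
    rw [List.range_succ, List.flatMap_append]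
    rcases Nat.lt_succ_iff_lt_or_eq.mp hm with h | rfl
    · rw [List.getElem?_append_left, ih h]
      rw [length_flatMap_range hφ]
      nlinarith
    · rw [List.getElem?_append_right (by rw [length_flatMap_range hφ]; omega),
        length_flatMap_range hφ]
      simp

theorem morphImage_mul_add (hφ : IsUniform φ k) (u : ℕ → A) (m : ℕ) {p : ℕ} (hp : p < k) (d : A) :
    morphImage φ u (k * m + p) = (φ (u m)).getD p d := by
  have hm : m < k * m + p + 1 := by nlinarith
  have h : p < (φ (u m)).length := by rw [hφ]; exact hp
  rw [morphImage, List.getD_eq_getElem?_getD, getElem?_flatMap_range hφ u hp hm,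
    List.getD_eq_getElem?_getD, List.getElem?_eq_getElem h]
  rfl

theorem morphImage_apply (hk : 0 < k) (hφ : IsUniform φ k) (u : ℕ → A) (n : ℕ) :
    morphImage φ u n = (φ (u (n / k))).getD (n % k) (u (n / k)) := by
  conv_lhs => rw [← Nat.div_add_mod n k]
  exact morphImage_mul_add hφ u _ (Nat.mod_lt _ hk) _

theorem shift_iterate_morphImage (hk : 0 < k) (hφ : IsUniform φ k) (u : ℕ → A) (n : ℕ) :
    shift^[k * n] (morphImage φ u) = morphImage φ (shift^[n] u) := by
  funext m
  rw [shift_iterate_apply, morphImage_apply hk hφ, morphImage_apply hk hφ, shift_iterate_apply,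
    Nat.add_mul_div_left _ _ hk, Nat.add_mul_mod_self_left]

theorem shift_iterate_morphImage_zero (hφ : IsUniform φ k) (u : ℕ → A) {p : ℕ} (hp : p < k)
    (d : A) : shift^[p] (morphImage φ u) 0 = (φ (u 0)).getD p d := by
  rw [shift_iterate_apply]
  simpa using morphImage_mul_add hφ u 0 hp d

theorem toLex_lt_iff {X : Type*} [LinearOrder X] {u v : ℕ → X} :
    toLex u < toLex v ↔ ∃ i, (∀ j < i, u j = v j) ∧ u i < v i := Iff.rfl

theorem toLex_le_iff_not_lt {X : Type*} [LinearOrder X] {u v : ℕ → X} :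
    toLex u ≤ toLex v ↔ ¬ toLex v < toLex u :=
  (not_lt (a := toLex v) (b := toLex u)).symm

theorem toLex_shift_iterate_lt {X : Type*} [LinearOrder X] {u v : ℕ → X} {p : ℕ}
    (h : ∀ j < p, u j = v j) :
    toLex (shift^[p] u) < toLex (shift^[p] v) ↔ toLex u < toLex v := by
  simp only [toLex_lt_iff, shift_iterate_apply]
  constructor
  · rintro ⟨i, h1, h2⟩
    refine ⟨i + p, fun j hj => ?_, h2⟩
    by_cases hjp : j < p
    · exact h j hjp
    · have := h1 (j - p) (by omega)
      rwa [Nat.sub_add_cancel (by omega)] at this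
  · rintro ⟨i, h1, h2⟩
    have hi : p ≤ i := by
      by_contra hc
      exact absurd (h i (by omega)) h2.ne
    refine ⟨i - p, fun j hj => h1 _ (by omega), ?_⟩
    rwa [Nat.sub_add_cancel hi]

theorem toLex_lt_of_zero_lt {X : Type*} [LinearOrder X] {u v : ℕ → X} (h : u 0 < v 0) :
    toLex u < toLex v :=
  toLex_lt_iff.mpr ⟨0, by simp, h⟩

open Classical in
/-- The pair `(u', p)` such that `u = σ^p (φ u')`; outside `L`, it is `(u, 0)`. -/
noncomputable def desub (φ : A → List A) (L : Set (ℕ → A)) (u : ℕ → A) : (ℕ → A) × ℕ :=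
  if h : u ∈ L ∧ ∃ q : (ℕ → A) × ℕ, IsDesubstitution φ L u q.1 q.2 then h.2.choose else (u, 0)

/-- The word `u'` such that `u = σ^p (φ u')`. -/
noncomputable def root (φ : A → List A) (L : Set (ℕ → A)) (u : ℕ → A) : ℕ → A := (desub φ L u).1

/-- The number `p` such that `u = σ^p (φ u')`. -/
noncomputable def offset (φ : A → List A) (L : Set (ℕ → A)) (u : ℕ → A) : ℕ := (desub φ L u).2

theorem isDesubstitution_root (hT : Typable φ L) {u : ℕ → A} (hu : u ∈ L) :
    IsDesubstitution φ L u (root φ L u) (offset φ L u) := by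
  have h : u ∈ L ∧ ∃ q : (ℕ → A) × ℕ, IsDesubstitution φ L u q.1 q.2 := ⟨hu, (hT u hu).exists⟩
  rw [root, offset, desub, dif_pos h]
  exact h.2.choose_spec

theorem root_of_notMem {u : ℕ → A} (hu : u ∉ L) : root φ L u = u := by
  rw [root, desub, dif_neg (fun h => hu h.1)]

theorem IsDesubstitution.eq (hT : Typable φ L) {u u' : ℕ → A} {p : ℕ} (hu : u ∈ L)
    (h : IsDesubstitution φ L u u' p) : root φ L u = u' ∧ offset φ L u = p :=
  Prod.ext_iff.mp ((hT u hu).unique (y₁ := (root φ L u, offset φ L u)) (y₂ := (u', p))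
    (isDesubstitution_root hT hu) h)

theorem hasType_iff (hT : Typable φ L) {u : ℕ → A} (hu : u ∈ L) (t : WordType φ) :
    HasType φ L u t ↔ root φ L u 0 = t.1 ∧ offset φ L u = t.2 := by
  constructor
  · rintro ⟨u', h, h0⟩
    obtain ⟨rfl, h2⟩ := h.eq hT hu
    exact ⟨h0, h2⟩
  · rintro ⟨h1, h2⟩
    exact ⟨root φ L u, h2 ▸ isDesubstitution_root hT hu, h1⟩

theorem exists_hasType (hT : Typable φ L) {u : ℕ → A} (hu : u ∈ L) : ∃ t, HasType φ L u t :=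
  ⟨⟨root φ L u 0, offset φ L u, (isDesubstitution_root hT hu).2.1⟩,
    (hasType_iff hT hu _).mpr ⟨rfl, rfl⟩⟩

theorem HasType.unique (hT : Typable φ L) {u : ℕ → A} (hu : u ∈ L) {s t : WordType φ}
    (hs : HasType φ L u s) (ht : HasType φ L u t) : s = t := by
  obtain ⟨a, p⟩ := s
  obtain ⟨b, q⟩ := t
  obtain ⟨h1, h2⟩ := (hasType_iff hT hu _).mp hs
  obtain ⟨h3, h4⟩ := (hasType_iff hT hu _).mp ht
  obtain rfl : a = b := h1.symm.trans h3
  obtain rfl : p = q := Fin.ext (h2.symm.trans h4)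
  rfl

theorem HasType.apply_zero (hφ : IsUniform φ k) {u : ℕ → A} {t : WordType φ}
    (h : HasType φ L u t) : u 0 = (φ t.1).get t.2 := by
  obtain ⟨u', ⟨-, -, h2⟩, h3⟩ := h
  have hp := t.2.2
  rw [h2, shift_iterate_morphImage_zero hφ u' (hφ t.1 ▸ hp) (u' 0), h3,
    List.getD_eq_getElem _ _ hp]
  rfl

/-- Follows from `σ^k ∘ φ = φ ∘ σ` and uniqueness of the desubstitution. This semiconjugacy makes
the image of an invariant measure under `root` invariant. -/
theorem root_shift_iterate (hk : 0 < k) (hφ : IsUniform φ k) (hT : Typable φ L)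
    (hL : Set.MapsTo shift L L) {u : ℕ → A} (hu : u ∈ L) :
    root φ L (shift^[k] u) = shift (root φ L u) := by
  obtain ⟨h1, h2, h3⟩ := isDesubstitution_root hT hu
  refine (IsDesubstitution.eq hT (hL.iterate k hu) (p := offset φ L u)
    ⟨hL h1, by rwa [hφ] at h2 ⊢, ?_⟩).1
  have := shift_iterate_morphImage hk hφ (root φ L u) 1
  rw [mul_one, Function.iterate_one] at this
  rw [← this, ← Function.iterate_add_apply, add_comm, Function.iterate_add_apply, ← h3]

theorem root_offset_shift (hφ : IsUniform φ k) (hT : Typable φ L)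
    (hL : Set.MapsTo shift L L) {u : ℕ → A} (hu : u ∈ L) (h : offset φ L u + 1 < k) :
    root φ L (shift u) = root φ L u ∧ offset φ L (shift u) = offset φ L u + 1 := by
  obtain ⟨h1, h2, h3⟩ := isDesubstitution_root hT hu
  refine IsDesubstitution.eq hT (hL hu) ⟨h1, by rwa [hφ], ?_⟩
  rw [Function.iterate_succ_apply', ← h3]

theorem offset_shift_eq_zero (hk : 0 < k) (hφ : IsUniform φ k) (hT : Typable φ L)
    (hL : Set.MapsTo shift L L) {u : ℕ → A} (hu : u ∈ L) (h : offset φ L u + 1 = k) :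
    offset φ L (shift u) = 0 := by
  obtain ⟨h1, h2, h3⟩ := isDesubstitution_root hT hu
  refine (IsDesubstitution.eq (u' := shift (root φ L u)) hT (hL hu) ⟨hL h1, by rwa [hφ], ?_⟩).2
  have := shift_iterate_morphImage hk hφ (root φ L u) 1
  rw [mul_one, Function.iterate_one] at this
  rw [Function.iterate_zero_apply, ← this]
  conv_lhs => rw [h3]
  conv_rhs => rw [← h]
  rw [Function.iterate_succ_apply']

theorem offset_lt (hφ : IsUniform φ k) (hT : Typable φ L) {u : ℕ → A} (hu : u ∈ L) :
    offset φ L u < k := hφ (root φ L u 0) ▸ (isDesubstitution_root hT hu).2.1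

/-- One step up the tower keeps the root. From the top level `k - 1` the shift returns to level `0`,
where both sides are false. -/
theorem shift_mem_offset_root_iff (hk : 0 < k) (hφ : IsUniform φ k) (hT : Typable φ L)
    (hL : Set.MapsTo shift L L) {u : ℕ → A} (hu : u ∈ L) {p : ℕ} (hp : p + 1 < k)
    (B : Set (ℕ → A)) :
    (offset φ L (shift u) = p + 1 ∧ root φ L (shift u) ∈ B) ↔
      (offset φ L u = p ∧ root φ L u ∈ B) := by
  rcases Nat.lt_or_eq_of_le (Nat.succ_le_of_lt (offset_lt hφ hT hu)) with h | h
  · obtain ⟨h1, h2⟩ := root_offset_shift hφ hT hL hu h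
    rw [h1, h2, Nat.add_right_cancel_iff]
  · have := offset_shift_eq_zero hk hφ hT hL hu h
    constructor <;> rintro ⟨h1, -⟩ <;> omega

/-- The images of two roots with the same first letter share their first `k` letters, so deleting `p
< k` of them does not affect the comparison. -/
theorem toLex_root_lt_iff {X : Type*} [LinearOrder X] {φ : X → List X} {L : Set (ℕ → X)}
    (hφ : IsUniform φ k) (hT : Typable φ L) (hord : OrderPreservingOn φ L) {u v : ℕ → X}
    (hu : u ∈ L) (hv : v ∈ L) (h0 : root φ L u 0 = root φ L v 0)
    (hp : offset φ L u = offset φ L v) :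
    toLex (root φ L u) < toLex (root φ L v) ↔ toLex u < toLex v := by
  obtain ⟨h1, h2, h3⟩ := isDesubstitution_root hT hu
  obtain ⟨h4, h5, h6⟩ := isDesubstitution_root hT hv
  rw [hord _ h1 _ h4]
  conv_rhs => rw [h3, h6, hp]
  refine (toLex_shift_iterate_lt fun j hj => ?_).symm
  have hjk : j < k := hj.trans (offset_lt hφ hT hv)
  have e1 := morphImage_mul_add hφ (root φ L u) 0 hjk (root φ L u 0)
  have e2 := morphImage_mul_add hφ (root φ L v) 0 hjk (root φ L u 0)
  rw [h0] at e1 e2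
  simpa using e1.trans e2.symm

end Words

/-! ### Continuity of the shift and of the morphism -/

section Topology

variable {A : Type*} [TopologicalSpace A] {φ : A → List A} {k : ℕ}

theorem continuous_shift : Continuous (shift : (ℕ → A) → ℕ → A) :=
  continuous_pi fun n => continuous_apply (n + 1)

theorem continuous_morphImage [DiscreteTopology A] (hk : 0 < k) (hφ : IsUniform φ k) :
    Continuous (morphImage φ) := by
  have : morphImage φ = fun u n => (fun a => (φ a).getD (n % k) a) (u (n / k)) := by
    funext u n
    exact morphImage_apply hk hφ u n
  rw [this]
  exact continuous_pi fun n => (continuous_of_discreteTopology (f := fun a => (φ a).getD (n % k) a)).comp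
    (continuous_apply (n / k))

theorem mapsTo_shift_subshift (w : ℕ → A) : Set.MapsTo shift (subshift w) (subshift w) := by
  refine Set.MapsTo.closure ?_ continuous_shift
  rintro _ ⟨n, rfl⟩
  exact ⟨n + 1, Function.iterate_succ_apply' _ _ _⟩

theorem shift_iterate_mem_subshift (w : ℕ → A) (n : ℕ) : shift^[n] w ∈ subshift w :=
  subset_closure ⟨n, rfl⟩

end Topology

/-! ### Measure of the levels of the tower -/

section Measure

theorem measureReal_eq_sum_fiber {Ω ι : Type*} [MeasurableSpace Ω] [Fintype ι] (μ : Measure Ω)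
    [IsFiniteMeasure μ] (E : Set Ω) (P : ι → Ω → Prop)
    (hm : ∀ i, MeasurableSet {u | u ∈ E ∧ P i u}) (h1 : ∀ u ∈ E, ∃ i, P i u)
    (h2 : ∀ u ∈ E, ∀ i j, P i u → P j u → i = j) :
    μ.real E = ∑ i, μ.real {u | u ∈ E ∧ P i u} := by
  rw [← measureReal_iUnion_fintype (fun i j hij => Set.disjoint_left.mpr
    fun u hi hj => hij (h2 u hi.1 i j hi.2 hj.2)) hm]
  congr 1
  ext u
  simp only [Set.mem_iUnion, Set.mem_ofPred_eq]
  exact ⟨fun h => (h1 u h).imp fun i hi => ⟨h, hi⟩, fun ⟨_, h, _⟩ => h⟩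

/-- Iteration gives `d x ≤ ρ ^ n * C` for all `n`. With `X` a space of pairs of measures, this
yields uniqueness statements. -/
theorem nonpos_of_le_mul_comp {X : Type*} (d : X → ℝ) (T : X → X) {C ρ : ℝ} (hρ : 0 ≤ ρ)
    (hρ1 : ρ < 1) (hC : ∀ x, d x ≤ C) (h : ∀ x, d x ≤ ρ * d (T x)) (x : X) : d x ≤ 0 := by
  have key : ∀ n x, d x ≤ ρ ^ n * C := by
    intro n
    induction n with
    | zero => simpa using hC
    | succ n ih =>
      intro x
      calc d x ≤ ρ * d (T x) := h x
        _ ≤ ρ * (ρ ^ n * C) := mul_le_mul_of_nonneg_left (ih _) hρ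
        _ = ρ ^ (n + 1) * C := by ring
  have := (tendsto_pow_atTop_nhds_zero_of_lt_one hρ hρ1).mul_const C
  rw [zero_mul] at this
  exact ge_of_tendsto' this fun n => key n x

variable {A : Type*} [MeasurableSpace A]
  {φ : A → List A} {k : ℕ} {L : Set (ℕ → A)} {μ : Measure (ℕ → A)}

theorem IsInvariantMeasureOn.ae_mem (hμ : IsInvariantMeasureOn μ L) : ∀ᵐ u ∂μ, u ∈ L :=
  mem_ae_iff.mpr hμ.2.1

theorem IsInvariantMeasureOn.measureReal_congr (hμ : IsInvariantMeasureOn μ L)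
    {S T : Set (ℕ → A)} (h : ∀ u ∈ L, u ∈ S ↔ u ∈ T) : μ.real S = μ.real T :=
  MeasureTheory.measureReal_congr (Filter.eventuallyEq_set.mpr (hμ.ae_mem.mono h))

/-- A measurable typable system of a `k`-uniform morphism which is stable under the shift. -/
structure TypableSystem (φ : A → List A) (k : ℕ) (L : Set (ℕ → A)) : Prop where
  pos : 0 < k
  uniform : IsUniform φ k
  typable : Typable φ L
  measurableSet : MeasurableSet L
  mapsTo : Set.MapsTo shift L L

theorem measurableSet_apply_zero_eq [DiscreteMeasurableSpace A] (a : A) :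
    MeasurableSet {x : ℕ → A | x 0 = a} :=
  (measurable_pi_apply (X := fun _ : ℕ => A) 0) (measurableSet_singleton a)

variable (hS : TypableSystem φ k L)
include hS

theorem measurableSet_offset_root [Countable A] [TopologicalSpace A] [DiscreteTopology A]
    [DiscreteMeasurableSpace A] {p : ℕ} (hp : p < k) {B : Set (ℕ → A)}
    (hB : MeasurableSet B) :
    MeasurableSet {u | u ∈ L ∧ offset φ L u = p ∧ root φ L u ∈ B} := by
  have hc : Continuous fun u => shift^[p] (morphImage φ u) :=
    (continuous_shift.iterate p).comp (continuous_morphImage hS.pos hS.uniform)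
  have hE : MeasurableSet ((L ∩ B) ∩ (fun u => shift^[p] (morphImage φ u)) ⁻¹' L) :=
    (hS.measurableSet.inter hB).inter (hc.measurable hS.measurableSet)
  have hi : ∀ x ∈ L, shift^[p] (morphImage φ x) ∈ L →
      root φ L (shift^[p] (morphImage φ x)) = x ∧ offset φ L (shift^[p] (morphImage φ x)) = p :=
    fun x hx h => IsDesubstitution.eq hS.typable h ⟨hx, by rwa [hS.uniform], rfl⟩
  have hinj : Set.InjOn (fun u => shift^[p] (morphImage φ u))
      ((L ∩ B) ∩ (fun u => shift^[p] (morphImage φ u)) ⁻¹' L) := by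
    rintro x ⟨⟨hx, -⟩, hx'⟩ y ⟨⟨hy, -⟩, hy'⟩ hxy
    rw [← (hi x hx hx').1, ← (hi y hy hy').1]
    exact congrArg (root φ L) hxy
  have : SecondCountableTopology A := inferInstance
  -- Lusin–Souslin: a continuous injective image of a Borel set is Borel. Injectivity is the
  -- uniqueness in typability.
  have himg := hE.image_of_continuousOn_injOn hc.continuousOn hinj
  have : {u | u ∈ L ∧ offset φ L u = p ∧ root φ L u ∈ B} =
      (fun u => shift^[p] (morphImage φ u)) ''
        ((L ∩ B) ∩ (fun u => shift^[p] (morphImage φ u)) ⁻¹' L) := by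
    ext u
    constructor
    · rintro ⟨hu, rfl, hB⟩
      obtain ⟨h1, h2, h3⟩ := isDesubstitution_root hS.typable hu
      exact ⟨root φ L u, ⟨⟨h1, hB⟩, by rw [Set.mem_preimage, ← h3]; exact hu⟩, h3.symm⟩
    · rintro ⟨x, ⟨⟨hx, hB⟩, h⟩, rfl⟩
      obtain ⟨h1, h2⟩ := hi x hx h
      exact ⟨h, h2, by rw [h1]; exact hB⟩
  rw [this]
  exact himg

theorem setOf_hasType_root (t : WordType φ) (B : Set (ℕ → A)) :
    {u | u ∈ L ∧ HasType φ L u t ∧ root φ L u ∈ B} =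
      {u | u ∈ L ∧ offset φ L u = t.2 ∧ root φ L u ∈ {x | x ∈ B ∧ x 0 = t.1}} := by
  ext u
  refine and_congr_right fun hu => ?_
  rw [hasType_iff hS.typable hu, Set.mem_ofPred_eq]
  tauto

variable [Countable A] [DiscreteMeasurableSpace A]

/-- On `L` the preimage is the union of its `k` levels; off `L` the default value makes `root` the
identity. -/
theorem measurable_root : Measurable (root φ L) := by
  let _ : TopologicalSpace A := ⊥
  have : DiscreteTopology A := ⟨rfl⟩
  intro B hB
  convert (MeasurableSet.iUnion fun p : Fin k => measurableSet_offset_root hS p.2 hB).union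
    (hS.measurableSet.compl.inter hB) using 1
  ext u
  by_cases hu : u ∈ L
  · have := offset_lt hS.uniform hS.typable hu
    simp only [Set.mem_preimage, Set.mem_union, Set.mem_iUnion, Set.mem_ofPred_eq, hu, true_and,
      Set.mem_inter_iff, Set.mem_compl_iff, not_true_eq_false, false_and, or_false]
    exact ⟨fun h => ⟨⟨_, this⟩, rfl, h⟩, fun ⟨_, _, h⟩ => h⟩
  · simp [hu, root_of_notMem hu]

theorem isInvariantMeasureOn_map_root (hμ : IsInvariantMeasureOn μ L) :
    IsInvariantMeasureOn (μ.map (root φ L)) L := by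
  have hr := measurable_root hS
  have hm := hμ.2.2.measurable
  have := hμ.1
  refine ⟨Measure.isProbabilityMeasure_map hr.aemeasurable, ?_, hm, ?_⟩
  · rw [Measure.map_apply hr hS.measurableSet.compl]
    refine measure_mono_null (t := Lᶜ) ?_ hμ.2.1
    exact fun u hu hL => hu (isDesubstitution_root hS.typable hL).1
  · have h : shift ∘ root φ L =ᵐ[μ] root φ L ∘ shift^[k] := hμ.ae_mem.mono fun u hu =>
      (root_shift_iterate hS.pos hS.uniform hS.typable hS.mapsTo hu).symm
    rw [Measure.map_map hm hr, Measure.map_congr h,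
      ← Measure.map_map hr (hm.iterate k), (hμ.2.2.iterate k).map_eq]

/-- By invariance the `k` levels over `B` have the same mass, and together they make up the preimage
of `B` under `root`. -/
theorem measureReal_offset_root (hμ : IsInvariantMeasureOn μ L) {p : ℕ} (hp : p < k)
    {B : Set (ℕ → A)} (hB : MeasurableSet B) :
    μ.real {u | u ∈ L ∧ offset φ L u = p ∧ root φ L u ∈ B} = (μ.map (root φ L)).real B / k := by
  let _ : TopologicalSpace A := ⊥
  have : DiscreteTopology A := ⟨rfl⟩
  have := hμ.1
  have hm : ∀ p < k, MeasurableSet {u | u ∈ L ∧ offset φ L u = p ∧ root φ L u ∈ B} :=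
    fun p hp => measurableSet_offset_root hS hp hB
  have step : ∀ p, p + 1 < k → μ.real {u | u ∈ L ∧ offset φ L u = p + 1 ∧ root φ L u ∈ B} =
      μ.real {u | u ∈ L ∧ offset φ L u = p ∧ root φ L u ∈ B} := by
    intro p hp
    rw [← hμ.2.2.measureReal_preimage (hm _ hp).nullMeasurableSet]
    refine hμ.measureReal_congr fun u hu => ?_
    have := shift_mem_offset_root_iff hS.pos hS.uniform hS.typable hS.mapsTo hu hp B
    simp only [Set.mem_preimage, Set.mem_ofPred_eq, hu, hS.mapsTo hu, true_and, this]
  have const : ∀ p < k, μ.real {u | u ∈ L ∧ offset φ L u = p ∧ root φ L u ∈ B} =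
      μ.real {u | u ∈ L ∧ offset φ L u = 0 ∧ root φ L u ∈ B} := by
    intro p
    induction p with
    | zero => intros; rfl
    | succ p ih => intro h; rw [step p h, ih (by omega)]
  have hsum := measureReal_eq_sum_fiber μ {u | u ∈ L ∧ root φ L u ∈ B}
    (fun (p : Fin k) u => offset φ L u = p)
    (fun p => by convert hm p p.2 using 1; ext u; simp only [Set.mem_ofPred_eq]; tauto)
    (fun u hu => ⟨⟨_, offset_lt hS.uniform hS.typable hu.1⟩, rfl⟩)
    (fun u _ i j hi hj => Fin.ext (hi.symm.trans hj))
  have hroot : (μ.map (root φ L)).real B = μ.real {u | u ∈ L ∧ root φ L u ∈ B} := by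
    rw [map_measureReal_apply (measurable_root hS) hB]
    exact hμ.measureReal_congr fun u hu => by simp [hu]
  have hk : (k : ℝ) ≠ 0 := Nat.cast_ne_zero.mpr hS.pos.ne'
  have hpart : ∀ i : Fin k, μ.real {u | u ∈ {u | u ∈ L ∧ root φ L u ∈ B} ∧ offset φ L u = i} =
      μ.real {u | u ∈ L ∧ offset φ L u = 0 ∧ root φ L u ∈ B} := by
    intro i
    rw [← const i i.2]
    congr 1
    ext u
    simp only [Set.mem_ofPred_eq]
    tauto
  rw [hroot, hsum, Finset.sum_congr rfl fun i _ => hpart i, const p hp, Finset.sum_const,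
    Finset.card_univ, Fintype.card_fin, nsmul_eq_mul, mul_div_cancel_left₀ _ hk]

theorem measurableSet_hasType_root (t : WordType φ) {B : Set (ℕ → A)} (hB : MeasurableSet B) :
    MeasurableSet {u | u ∈ L ∧ HasType φ L u t ∧ root φ L u ∈ B} := by
  let _ : TopologicalSpace A := ⊥
  have : DiscreteTopology A := ⟨rfl⟩
  rw [setOf_hasType_root hS]
  exact measurableSet_offset_root hS (hS.uniform t.1 ▸ t.2.2) (hB.inter (measurableSet_apply_zero_eq _))

theorem measureReal_hasType_root (hμ : IsInvariantMeasureOn μ L) (t : WordType φ)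
    {B : Set (ℕ → A)} (hB : MeasurableSet B) :
    μ.real {u | u ∈ L ∧ HasType φ L u t ∧ root φ L u ∈ B} =
      (μ.map (root φ L)).real {x | x ∈ B ∧ x 0 = t.1} / k := by
  rw [setOf_hasType_root hS]
  exact measureReal_offset_root hS hμ (hS.uniform t.1 ▸ t.2.2) (hB.inter (measurableSet_apply_zero_eq _))

theorem measureReal_hasType (hμ : IsInvariantMeasureOn μ L) (t : WordType φ) :
    μ.real {u | u ∈ L ∧ HasType φ L u t} = letterFreq (μ.map (root φ L)) L t.1 / k := by
  rw [letterFreq, ← measureReal_hasType_root hS hμ t hS.measurableSet]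
  congr 1
  ext u
  simp only [Set.mem_ofPred_eq]
  exact ⟨fun h => ⟨h.1, h.2, (isDesubstitution_root hS.typable h.1).1⟩, fun h => ⟨h.1, h.2.1⟩⟩

theorem measurableSet_hasType (t : WordType φ) : MeasurableSet {u | u ∈ L ∧ HasType φ L u t} := by
  simpa using measurableSet_hasType_root hS t MeasurableSet.univ

end Measure

/-! ### Column sums of the incidence matrix -/

section Matrix

variable {A : Type*} [DecidableEq A] {φ : A → List A} {k : ℕ}

theorem sum_boole_get (l : List A) (a : A) :
    ∑ i : Fin l.length, (if l.get i = a then (1 : ℝ) else 0) = l.count a := by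
  induction l with
  | nil => simp
  | cons b l ih =>
    refine (Fin.sum_univ_succ (n := l.length) _).trans ?_
    rw [List.count_cons, Nat.cast_add, ← ih, add_comm]
    by_cases h : b = a <;> simp [h]

theorem sum_incidenceMatrix [Fintype A] (hφ : IsUniform φ k) (b : A) :
    ∑ a, incidenceMatrix φ a b = k := by
  simp only [incidenceMatrix, Matrix.of_apply]
  rw [← Nat.cast_sum, ← hφ b]
  simp [← Multiset.coe_count]

end Matrix

/-! ### Letter frequencies under desubstitution -/

section Frequencies

variable {A : Type*} [MeasurableSpace A] [Fintype A] [DiscreteMeasurableSpace A]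
  {φ : A → List A} {k : ℕ} {L : Set (ℕ → A)} {μ : Measure (ℕ → A)}

theorem sum_letterFreq (hL : MeasurableSet L) (hμ : IsInvariantMeasureOn μ L) :
    ∑ a, letterFreq μ L a = 1 := by
  have := hμ.1
  have h := measureReal_eq_sum_fiber μ L (fun a u => u 0 = a)
    (fun a => hL.inter (measurableSet_apply_zero_eq a))
    (fun u _ => ⟨u 0, rfl⟩) (fun u _ i j hi hj => hi.symm.trans hj)
  rw [← hμ.measureReal_congr (S := Set.univ) fun u hu => by simp [hu]] at h
  simpa [letterFreq] using h.symm

/-- The cylinder of `a` is the union of the types `(b, p)` for which `φ b` has `a` at place `p`;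
each has mass `μ'_b / k`, and their number for given `b` is the matrix entry. -/
theorem letterFreq_eq_mulVec [DecidableEq A] (hS : TypableSystem φ k L) (hμ : IsInvariantMeasureOn μ L) :
    letterFreq μ L = (k : ℝ)⁻¹ • (incidenceMatrix φ).mulVec (letterFreq (μ.map (root φ L)) L) := by
  classical
  have := hμ.1
  funext a
  have hset : ∀ t : WordType φ, {u | u ∈ {u | u ∈ L ∧ u 0 = a} ∧ HasType φ L u t} =
      if (φ t.1).get t.2 = a then {u | u ∈ L ∧ HasType φ L u t} else ∅ := by
    intro t
    split_ifs with h
    · ext u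
      simp only [Set.mem_ofPred_eq]
      exact ⟨fun h => ⟨h.1.1, h.2⟩,
        fun h' => ⟨⟨h'.1, (h'.2.apply_zero hS.uniform).trans h⟩, h'.2⟩⟩
    · ext u
      simp only [Set.mem_ofPred_eq, Set.mem_empty_iff_false, iff_false]
      exact fun h' => h ((h'.2.apply_zero hS.uniform).symm.trans h'.1.2)
  rw [letterFreq, measureReal_eq_sum_fiber μ {u | u ∈ L ∧ u 0 = a} (fun t u => HasType φ L u t)
    (fun t => by rw [hset]; split_ifs; exacts [measurableSet_hasType hS t, MeasurableSet.empty])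
    (fun u hu => exists_hasType hS.typable hu.1)
    (fun u hu s t => HasType.unique hS.typable hu.1)]
  simp only [hset, apply_ite μ.real, measureReal_empty, measureReal_hasType hS hμ,
    Pi.smul_apply, Matrix.mulVec, dotProduct, incidenceMatrix, Matrix.of_apply, smul_eq_mul]
  rw [Fintype.sum_sigma, Finset.mul_sum]
  refine Finset.sum_congr rfl fun b _ => ?_
  rw [← sum_boole_get, Finset.sum_mul, Finset.mul_sum]
  refine Finset.sum_congr rfl fun i _ => ?_
  split_ifs <;> simp [div_eq_inv_mul]

end Frequencies

/-! ### Contraction of zero-sum vectors in the `ℓ¹` norm -/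

section Contraction

variable {A : Type*} [Fintype A]

/-- Doeblin's argument: on zero-sum vectors `c` may be subtracted from every entry, which leaves a
nonnegative matrix with column sums `s - c * card A`. -/
theorem sum_abs_mulVec_le (N : Matrix A A ℝ) {c s : ℝ} (hc : ∀ a b, c ≤ N a b)
    (hs : ∀ b, ∑ a, N a b = s) (x : A → ℝ) (hx : ∑ b, x b = 0) :
    ∑ a, |N.mulVec x a| ≤ (s - c * Fintype.card A) * ∑ b, |x b| := by
  have h : ∀ a, N.mulVec x a = ∑ b, (N a b - c) * x b := by
    intro a
    simp only [Matrix.mulVec, dotProduct, sub_mul, Finset.sum_sub_distrib, ← Finset.mul_sum, hx]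
    simp
  calc ∑ a, |N.mulVec x a| ≤ ∑ a, ∑ b, (N a b - c) * |x b| := by
        refine Finset.sum_le_sum fun a _ => ?_
        rw [h]
        refine (Finset.abs_sum_le_sum_abs _ _).trans (Finset.sum_le_sum fun b _ => ?_)
        rw [abs_mul, abs_of_nonneg (sub_nonneg.mpr (hc a b))]
    _ = ∑ b, (s - c * Fintype.card A) * |x b| := by
        rw [Finset.sum_comm]
        refine Finset.sum_congr rfl fun b _ => ?_
        rw [← Finset.sum_mul, Finset.sum_sub_distrib, hs, Finset.sum_const, Finset.card_univ,
          nsmul_eq_mul, mul_comm c]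
    _ = _ := by rw [Finset.mul_sum]

theorem sum_pow_apply [DecidableEq A] (M : Matrix A A ℝ) {s : ℝ} (hs : ∀ b, ∑ a, M a b = s)
    (m : ℕ) (b : A) : ∑ a, (M ^ m) a b = s ^ m := by
  induction m generalizing b with
  | zero => simp [Matrix.one_apply]
  | succ m ih =>
    simp only [pow_succ, Matrix.mul_apply]
    rw [Finset.sum_comm]
    simp only [← Finset.sum_mul, ih, ← Finset.mul_sum, hs]

end Contraction

/-! ### Positivity and uniqueness of the letter frequencies -/

section Frequencies

variable {A : Type*} [MeasurableSpace A] [Fintype A] [DiscreteMeasurableSpace A]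
  {φ : A → List A} {k : ℕ} {L : Set (ℕ → A)} {μ μ' : Measure (ℕ → A)}

theorem isInvariantMeasureOn_iterate (hS : TypableSystem φ k L) (hμ : IsInvariantMeasureOn μ L)
    (m : ℕ) : IsInvariantMeasureOn ((fun μ => μ.map (root φ L))^[m] μ) L := by
  induction m generalizing μ with
  | zero => exact hμ
  | succ m ih => exact ih (isInvariantMeasureOn_map_root hS hμ)

variable [DecidableEq A]

theorem letterFreq_eq_pow_mulVec (hS : TypableSystem φ k L) (hμ : IsInvariantMeasureOn μ L)
    (m : ℕ) : letterFreq μ L = ((k : ℝ) ^ m)⁻¹ • (incidenceMatrix φ ^ m).mulVec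
      (letterFreq ((fun μ => μ.map (root φ L))^[m] μ) L) := by
  induction m generalizing μ with
  | zero => simp
  | succ m ih =>
    rw [letterFreq_eq_mulVec hS hμ, ih (isInvariantMeasureOn_map_root hS hμ),
      Matrix.mulVec_smul, Matrix.mulVec_mulVec, smul_smul, ← mul_inv, ← pow_succ', ← pow_succ',
      Function.iterate_succ_apply]

/-- A positive power of the matrix sends a nonnegative nonzero vector to a positive one. -/
theorem letterFreq_pos (hS : TypableSystem φ k L) (hprim : IsPrimitive φ)
    (hμ : IsInvariantMeasureOn μ L) (a : A) : 0 < letterFreq μ L a := by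
  obtain ⟨m, -, hm⟩ := hprim.exists_pos_pow
  have hT := isInvariantMeasureOn_iterate hS hμ m
  have hk : (0 : ℝ) < k := Nat.cast_pos.mpr hS.pos
  rw [letterFreq_eq_pow_mulVec hS hμ m, Pi.smul_apply, smul_eq_mul, Matrix.mulVec, dotProduct]
  refine mul_pos (by positivity) ?_
  have hsum := sum_letterFreq hS.measurableSet hT
  have hnn : ∀ b, 0 ≤ letterFreq ((fun μ => μ.map (root φ L))^[m] μ) L b :=
    fun b => measureReal_nonneg
  obtain ⟨b, -, hb⟩ := Finset.exists_lt_of_sum_lt (s := Finset.univ) (f := fun _ : A => (0 : ℝ))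
    (g := letterFreq ((fun μ => μ.map (root φ L))^[m] μ) L) (by simp [hsum])
  exact Finset.sum_pos' (fun b _ => mul_nonneg (hm a b).le (hnn b))
    ⟨b, Finset.mem_univ b, mul_pos (hm a b) hb⟩

theorem letterFreq_unique (hS : TypableSystem φ k L) (hprim : IsPrimitive φ)
    (hμ : IsInvariantMeasureOn μ L) (hμ' : IsInvariantMeasureOn μ' L) :
    letterFreq μ L = letterFreq μ' L := by
  obtain ⟨m, -, hm⟩ := hprim.exists_pos_pow
  have hk : (0 : ℝ) < k := Nat.cast_pos.mpr hS.pos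
  have hne : Nonempty A := by
    by_contra h
    rw [not_nonempty_iff] at h
    simpa using sum_letterFreq hS.measurableSet hμ
  obtain ⟨⟨i, j⟩, hij⟩ := Finite.exists_min fun q : A × A => (incidenceMatrix φ ^ m) q.1 q.2
  set c := (incidenceMatrix φ ^ m) i j with hc
  have hcle : ∀ a b, c ≤ (incidenceMatrix φ ^ m) a b := fun a b => hij (a, b)
  have hsum := sum_pow_apply (incidenceMatrix φ) (sum_incidenceMatrix hS.uniform) m
  have hcard : (0 : ℝ) < Fintype.card A := Nat.cast_pos.mpr Fintype.card_pos
  have hccard : c * Fintype.card A ≤ (k : ℝ) ^ m := by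
    rw [← hsum j, mul_comm, ← nsmul_eq_mul]
    exact Finset.card_nsmul_le_sum _ _ _ fun a _ => hcle a j
  -- The contraction runs over all pairs of invariant measures, since desubstitution changes both.
  -- The factor `ρ = 1 - c * card A / k ^ m` is less than `1` because the least entry `c` of the
  -- positive power is positive.
  let X := {q : Measure (ℕ → A) × Measure (ℕ → A) //
    IsInvariantMeasureOn q.1 L ∧ IsInvariantMeasureOn q.2 L}
  let T : X → X := fun q => ⟨⟨_, _⟩, isInvariantMeasureOn_iterate hS q.2.1 m,
    isInvariantMeasureOn_iterate hS q.2.2 m⟩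
  have key := nonpos_of_le_mul_comp
    (fun q : X => ∑ a, |letterFreq q.1.1 L a - letterFreq q.1.2 L a|) T (C := 2)
    (ρ := ((k : ℝ) ^ m)⁻¹ * ((k : ℝ) ^ m - c * Fintype.card A))
    (mul_nonneg (by positivity) (sub_nonneg.mpr hccard))
    (by
      rw [mul_sub, inv_mul_cancel₀ (by positivity)]
      have := hm i j
      have : 0 < ((k : ℝ) ^ m)⁻¹ * (c * Fintype.card A) := by positivity
      linarith)
    (by
      rintro ⟨⟨μ₁, μ₂⟩, h₁, h₂⟩
      have e₁ := sum_letterFreq hS.measurableSet h₁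
      have e₂ := sum_letterFreq hS.measurableSet h₂
      calc ∑ a, |letterFreq μ₁ L a - letterFreq μ₂ L a|
          ≤ ∑ a, (letterFreq μ₁ L a + letterFreq μ₂ L a) := by
            refine Finset.sum_le_sum fun a _ => (abs_sub _ _).trans ?_
            rw [letterFreq, letterFreq, abs_of_nonneg measureReal_nonneg,
              abs_of_nonneg measureReal_nonneg]
        _ = 2 := by rw [Finset.sum_add_distrib, e₁, e₂]; norm_num)
    (by
      rintro ⟨⟨μ₁, μ₂⟩, h₁, h₂⟩
      have e₁ := sum_letterFreq hS.measurableSet (isInvariantMeasureOn_iterate hS h₁ m)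
      have e₂ := sum_letterFreq hS.measurableSet (isInvariantMeasureOn_iterate hS h₂ m)
      have := sum_abs_mulVec_le _ hcle hsum
        (letterFreq ((fun μ => μ.map (root φ L))^[m] μ₁) L -
          letterFreq ((fun μ => μ.map (root φ L))^[m] μ₂) L)
        (by simp [Finset.sum_sub_distrib, e₁, e₂])
      rw [mul_assoc]
      refine le_trans (le_of_eq ?_)
        (mul_le_mul_of_nonneg_left this (inv_nonneg.mpr (pow_nonneg hk.le m)))
      rw [Finset.mul_sum]
      refine Finset.sum_congr rfl fun a _ => ?_
      rw [letterFreq_eq_pow_mulVec hS h₁ m, letterFreq_eq_pow_mulVec hS h₂ m, Matrix.mulVec_sub]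
      simp only [Pi.smul_apply, Pi.sub_apply, smul_eq_mul]
      rw [← mul_sub, abs_mul, abs_of_nonneg (inv_nonneg.mpr (pow_nonneg hk.le m))])
    ⟨⟨μ, μ'⟩, hμ, hμ'⟩
  funext a
  have h0 := (Finset.sum_eq_zero_iff_of_nonneg fun a _ => abs_nonneg _).mp
    (le_antisymm key (Finset.sum_nonneg fun a _ => abs_nonneg _)) a (Finset.mem_univ a)
  exact sub_eq_zero.mp (abs_eq_zero.mp h0)

end Frequencies

/-! ### The distribution function `ν` and its self-similarity -/

section Distribution

variable {A : Type*} [MeasurableSpace A] [Fintype A] [LinearOrder A] [DiscreteMeasurableSpace A]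
  {φ : A → List A} {k : ℕ} {L : Set (ℕ → A)} {μ μ' : Measure (ℕ → A)}
  {r : WordType φ → WordType φ → Prop}

theorem measurableSet_toLex_le (v : ℕ → A) : MeasurableSet {u : ℕ → A | toLex u ≤ toLex v} := by
  have : {u : ℕ → A | toLex u ≤ toLex v} =
      (⋃ i : ℕ, (⋂ j : ℕ, ⋂ _ : j < i, (fun u : ℕ → A => u j) ⁻¹' {v j}) ∩
        (fun u : ℕ → A => u i) ⁻¹' Set.Ioi (v i))ᶜ := by
    ext u
    rw [Set.mem_compl_iff, Set.mem_ofPred_eq, toLex_le_iff_not_lt, toLex_lt_iff]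
    simp [eq_comm]
  rw [this]
  exact (MeasurableSet.iUnion fun i => (MeasurableSet.iInter fun j => MeasurableSet.iInter fun _ =>
    measurable_pi_apply j (measurableSet_singleton _)).inter
      (measurable_pi_apply i (MeasurableSet.of_discrete))).compl

theorem nu_eq_lowerI_add (hL : MeasurableSet L) (hμ : IsInvariantMeasureOn μ L) (v : ℕ → A) :
    nu μ L v = lowerI μ L (v 0) + μ.real {u | (u ∈ L ∧ toLex u ≤ toLex v) ∧ u 0 = v 0} := by
  classical
  have := hμ.1
  have hm : ∀ a, MeasurableSet {u | u ∈ {u | u ∈ L ∧ toLex u ≤ toLex v} ∧ u 0 = a} :=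
    fun a => (hL.inter (measurableSet_toLex_le v)).inter (measurableSet_apply_zero_eq a)
  rw [nu, measureReal_eq_sum_fiber μ _ (fun a u => u 0 = a) hm (fun u _ => ⟨_, rfl⟩)
    (fun u _ i j hi hj => hi.symm.trans hj), lowerI, Finset.sum_filter,
    ← Finset.sum_erase_add _ _ (Finset.mem_univ (v 0)),
    ← Finset.sum_erase_add (Finset.univ : Finset A) (fun a => if a < v 0 then letterFreq μ L a else 0)
      (Finset.mem_univ (v 0)), if_neg (lt_irrefl _), add_zero]
  congr 1
  refine Finset.sum_congr rfl fun a ha => ?_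
  split_ifs with h
  · rw [letterFreq]
    congr 1
    ext u
    simp only [Set.mem_ofPred_eq]
    refine ⟨fun h => ⟨h.1.1, h.2⟩, fun h' => ⟨⟨h'.1, ?_⟩, h'.2⟩⟩
    exact (toLex_lt_of_zero_lt (h'.2 ▸ h)).le
  · rw [← measureReal_empty (μ := μ)]
    congr 1
    ext u
    simp only [Set.mem_ofPred_eq, Set.mem_empty_iff_false, iff_false]
    rintro ⟨⟨-, h1⟩, rfl⟩
    have h2 : v 0 < u 0 := lt_of_le_of_ne (not_lt.mp h) (Finset.ne_of_mem_erase ha).symm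
    exact absurd (toLex_lt_of_zero_lt h2) (not_lt.mpr h1)

/-- Smaller types lie wholly below `v` and larger ones wholly above. Inside the type of `v` the
order is that of the roots, so the contribution is `1/k` times the mass of the words below `root φ L
v` with the same first letter. -/
theorem nu_eq_lowerJ_add (hS : TypableSystem φ k L) (hord : OrderPreservingOn φ L)
    (hr : IsTypeOrder φ L r) (hμ : IsInvariantMeasureOn μ L) {v : ℕ → A} (hv : v ∈ L)
    {t : WordType φ} (ht : HasType φ L v t) :
    nu μ L v = lowerJ (μ.map (root φ L)) L φ k r t +
      (nu (μ.map (root φ L)) L (root φ L v) - lowerI (μ.map (root φ L)) L t.1) / k := by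
  classical
  have := hμ.1
  have := hr.1
  have hT := isInvariantMeasureOn_map_root hS hμ
  obtain ⟨hv0, hvp⟩ := (hasType_iff hS.typable hv t).mp ht
  have hm : ∀ s, MeasurableSet
      {u | u ∈ {u | u ∈ L ∧ toLex u ≤ toLex v} ∧ HasType φ L u s} := by
    intro s
    convert (measurableSet_hasType hS s).inter (measurableSet_toLex_le v) using 1
    ext u
    simp only [Set.mem_ofPred_eq, Set.mem_inter_iff]
    tauto
  have hdiag : μ.real {u | u ∈ {u | u ∈ L ∧ toLex u ≤ toLex v} ∧ HasType φ L u t} =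
      (nu (μ.map (root φ L)) L (root φ L v) - lowerI (μ.map (root φ L)) L t.1) / k := by
    rw [nu_eq_lowerI_add hS.measurableSet hT, hv0, add_sub_cancel_left]
    have h := measureReal_hasType_root hS hμ t
      (hS.measurableSet.inter (measurableSet_toLex_le (root φ L v)))
    refine Eq.trans ?_ h
    congr 1
    ext u
    simp only [Set.mem_ofPred_eq, Set.mem_inter_iff]
    constructor
    · rintro ⟨⟨hu, hle⟩, hut⟩
      obtain ⟨hu0, hup⟩ := (hasType_iff hS.typable hu t).mp hut
      refine ⟨hu, hut, (isDesubstitution_root hS.typable hu).1, ?_⟩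
      rwa [toLex_le_iff_not_lt, toLex_root_lt_iff hS.uniform hS.typable hord hv hu (hv0.trans hu0.symm)
        (hvp.trans hup.symm), ← toLex_le_iff_not_lt]
    · rintro ⟨hu, hut, -, hle⟩
      obtain ⟨hu0, hup⟩ := (hasType_iff hS.typable hu t).mp hut
      refine ⟨⟨hu, ?_⟩, hut⟩
      rwa [toLex_le_iff_not_lt, toLex_root_lt_iff hS.uniform hS.typable hord hv hu (hv0.trans hu0.symm)
        (hvp.trans hup.symm), ← toLex_le_iff_not_lt] at hle
  rw [nu, measureReal_eq_sum_fiber μ _ (fun t u => HasType φ L u t) hm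
    (fun u hu => exists_hasType hS.typable hu.1)
    (fun u hu s t => HasType.unique hS.typable hu.1), ← hdiag, lowerJ, Finset.sum_filter,
    ← Finset.sum_erase_add _ _ (Finset.mem_univ t),
    ← Finset.sum_erase_add (Finset.univ : Finset (WordType φ))
      (fun s => if r s t then letterFreq (μ.map (root φ L)) L s.1 / k else 0)
      (Finset.mem_univ t), if_neg (irrefl t), add_zero]
  congr 1
  refine Finset.sum_congr rfl fun s hs => ?_
  split_ifs with h
  · rw [← measureReal_hasType hS hμ]
    congr 1
    ext u
    simp only [Set.mem_ofPred_eq]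
    exact ⟨fun h => ⟨h.1.1, h.2⟩,
      fun h' => ⟨⟨h'.1, (hr.2 u h'.1 v hv s t h'.2 ht h).le⟩, h'.2⟩⟩
  · rw [← measureReal_empty (μ := μ)]
    congr 1
    ext u
    simp only [Set.mem_ofPred_eq, Set.mem_empty_iff_false, iff_false]
    rintro ⟨⟨hu, h1⟩, hus⟩
    rcases trichotomous_of r s t with h2 | h2 | h2
    · exact h h2
    · exact Finset.ne_of_mem_erase hs h2
    · exact absurd (hr.2 v hv u hu t s ht hus h2) (not_lt.mpr h1)

/-- Both measures give the same interval ends by `letterFreq_unique`, so the constants cancel and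
the difference at `v` is exactly `1/k` times the difference of the image measures at the root. -/
theorem nu_unique (hS : TypableSystem φ k L) (hk : 2 ≤ k) (hprim : IsPrimitive φ)
    (hord : OrderPreservingOn φ L) (hr : IsTypeOrder φ L r) (hμ : IsInvariantMeasureOn μ L)
    (hμ' : IsInvariantMeasureOn μ' L) {v : ℕ → A} (hv : v ∈ L) : nu μ L v = nu μ' L v := by
  have hk' : (2 : ℝ) ≤ k := by exact_mod_cast hk
  let X := {q : (Measure (ℕ → A) × Measure (ℕ → A)) × (ℕ → A) //
    (IsInvariantMeasureOn q.1.1 L ∧ IsInvariantMeasureOn q.1.2 L) ∧ q.2 ∈ L}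
  let T : X → X := fun q => ⟨⟨⟨_, _⟩, root φ L q.1.2⟩,
    ⟨isInvariantMeasureOn_map_root hS q.2.1.1, isInvariantMeasureOn_map_root hS q.2.1.2⟩,
    (isDesubstitution_root hS.typable q.2.2).1⟩
  have key := nonpos_of_le_mul_comp
    (fun q : X => |nu q.1.1.1 L q.1.2 - nu q.1.1.2 L q.1.2|) T (C := 1)
    (ρ := (k : ℝ)⁻¹) (by positivity) (inv_lt_one_of_one_lt₀ (by linarith))
    (by
      rintro ⟨⟨⟨μ₁, μ₂⟩, v⟩, ⟨h₁, h₂⟩, -⟩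
      have := h₁.1
      have := h₂.1
      exact abs_sub_le_of_nonneg_of_le measureReal_nonneg measureReal_le_one
        measureReal_nonneg measureReal_le_one)
    (by
      rintro ⟨⟨⟨μ₁, μ₂⟩, v⟩, ⟨h₁, h₂⟩, hv⟩
      obtain ⟨t, ht⟩ := exists_hasType hS.typable hv
      have hfreq := letterFreq_unique hS hprim (isInvariantMeasureOn_map_root hS h₁)
        (isInvariantMeasureOn_map_root hS h₂)
      have e₁ := nu_eq_lowerJ_add hS hord hr h₁ hv ht
      have e₂ := nu_eq_lowerJ_add hS hord hr h₂ hv ht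
      simp only [lowerJ, lowerI, hfreq] at e₁ e₂
      rw [← abs_of_nonneg (show (0 : ℝ) ≤ (k : ℝ)⁻¹ by positivity), ← abs_mul]
      refine le_of_eq (congrArg abs ?_)
      change nu μ₁ L v - nu μ₂ L v = (k : ℝ)⁻¹ * (nu (μ₁.map (root φ L)) L (root φ L v) -
        nu (μ₂.map (root φ L)) L (root φ L v))
      rw [e₁, e₂]
      ring)
    ⟨⟨⟨μ, μ'⟩, v⟩, ⟨hμ, hμ'⟩, hv⟩
  exact sub_eq_zero.mp (abs_eq_zero.mp (le_antisymm key (abs_nonneg _)))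

theorem nu_eq_nu_root_div_add (hS : TypableSystem φ k L) (hk : 2 ≤ k) (hprim : IsPrimitive φ)
    (hord : OrderPreservingOn φ L) (hr : IsTypeOrder φ L r) (hμ : IsInvariantMeasureOn μ L)
    {v : ℕ → A} (hv : v ∈ L) {t : WordType φ} (ht : HasType φ L v t) :
    nu μ L v = nu μ L (root φ L v) / k + intervalConst μ L φ k r t := by
  have hT := isInvariantMeasureOn_map_root hS hμ
  rw [nu_eq_lowerJ_add hS hord hr hμ hv ht, nu_unique hS hk hprim hord hr hT hμ
    (isDesubstitution_root hS.typable hv).1, intervalConst]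
  simp only [lowerJ, lowerI, letterFreq_unique hS hprim hT hμ]
  ring

end Distribution

/-! ### The Perron–Frobenius eigenvalue of a uniform morphism -/

section Perron

variable {A : Type*} [Fintype A] [DecidableEq A] {φ : A → List A} {k : ℕ}

/-- The all-ones row vector is a left eigenvector; the vanishing determinant turns it into a right
one. -/
theorem hasEigenvalue_natCast [Nonempty A] (hφ : IsUniform φ k) :
    Module.End.HasEigenvalue
      (Matrix.toLin' ((incidenceMatrix φ).map (fun x : ℝ => (x : ℂ)))) (k : ℂ) := by
  set N := (incidenceMatrix φ).map (fun x : ℝ => (x : ℂ)) with hN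
  have hsum : ∀ b, ∑ a, N a b = k := by
    intro b
    have := sum_incidenceMatrix hφ b
    simp only [hN, Matrix.map_apply]
    exact_mod_cast this
  have hdet : (N - (k : ℂ) • (1 : Matrix A A ℂ)).det = 0 := by
    refine Matrix.exists_vecMul_eq_zero_iff.mp ⟨fun _ => 1, ?_, ?_⟩
    · exact fun h => one_ne_zero (congrFun h (Classical.arbitrary A))
    · funext b
      simp [Matrix.vecMul, dotProduct, Finset.sum_sub_distrib, hsum, Matrix.one_apply]
  obtain ⟨v, hv, hv0⟩ := Matrix.exists_mulVec_eq_zero_iff.mpr hdet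
  refine Module.End.hasEigenvalue_of_hasEigenvector
    (Module.End.hasEigenvector_iff.mpr ⟨Module.End.mem_eigenspace_iff.mpr ?_, hv⟩)
  rw [Matrix.sub_mulVec, Matrix.smul_mulVec, Matrix.one_mulVec, sub_eq_zero] at hv0
  rw [Matrix.toLin'_apply, hv0]

/-- The `ℓ¹` operator norm of a nonnegative matrix is its largest column sum. -/
theorem norm_eigenvalue_le (hφ : IsUniform φ k) {z : ℂ}
    (hz : Module.End.HasEigenvalue
      (Matrix.toLin' ((incidenceMatrix φ).map (fun x : ℝ => (x : ℂ)))) z) : ‖z‖ ≤ k := by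
  obtain ⟨v, hv, hv0⟩ := hz.exists_hasEigenvector
  rw [Module.End.mem_eigenspace_iff, Matrix.toLin'_apply] at hv
  have hpos : 0 < ∑ a, ‖v a‖ := by
    obtain ⟨a, ha⟩ := Function.ne_iff.mp hv0
    exact Finset.sum_pos' (fun _ _ => norm_nonneg _) ⟨a, Finset.mem_univ a, norm_pos_iff.mpr ha⟩
  refine le_of_mul_le_mul_right ?_ hpos
  calc ‖z‖ * ∑ a, ‖v a‖ = ∑ a, ‖z * v a‖ := by simp only [Finset.mul_sum, norm_mul]
    _ ≤ ∑ a, ∑ b, incidenceMatrix φ a b * ‖v b‖ := by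
        refine Finset.sum_le_sum fun a _ => ?_
        rw [← smul_eq_mul, ← Pi.smul_apply, ← hv]
        refine (norm_sum_le _ _).trans (Finset.sum_le_sum fun b _ => ?_)
        rw [norm_mul]
        simp [incidenceMatrix]
    _ = k * ∑ b, ‖v b‖ := by
        rw [Finset.sum_comm, Finset.mul_sum]
        exact Finset.sum_congr rfl fun b _ => by rw [← Finset.sum_mul, sum_incidenceMatrix hφ]

theorem IsPerronEigenvalue.eq_natCast [Nonempty A] (hφ : IsUniform φ k) {θ : ℝ}
    (hθ : IsPerronEigenvalue (incidenceMatrix φ) θ) : θ = k := by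
  obtain ⟨h0, h1, h2⟩ := hθ
  by_contra hne
  have h := h2 k (hasEigenvalue_natCast hφ) (fun h => hne (by exact_mod_cast h.symm))
  have h' := norm_eigenvalue_le hφ h1
  rw [Complex.norm_natCast] at h
  rw [Complex.norm_real, Real.norm_of_nonneg h0.le] at h'
  exact absurd h h'.not_gt

end Perron

/-! ### Regularity from a recurrence -/

section Regular

theorem isRegularSeq_of_stable {R S : Type*} [CommRing R] [CommRing S] [Algebra R S]
    [IsNoetherianRing R] {k : ℕ} (hk : 0 < k) {s : ℕ → S} (V : Submodule R (ℕ → S)) (hV : V.FG)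
    (hs : s ∈ V) (hstep : ∀ t ∈ V, ∀ p < k, (fun n => t (k * n + p)) ∈ V) :
    IsRegularSeq R k s := by
  have hker : ∀ e j, j < k ^ e → (fun n => s (k ^ e * n + j)) ∈ V := by
    intro e
    induction e with
    | zero => intro j hj; obtain rfl : j = 0 := by simpa using hj
              simpa using hs
    | succ e ih =>
      intro j hj
      -- The leading base-`k` digit `p` of `j` is split off: `k^(e+1) n + j = k^e (k n + p) + j %
      -- k^e`.
      have hlt : j / k ^ e < k := Nat.div_lt_of_lt_mul (by rwa [← pow_succ])
      have := hstep _ (ih (j % k ^ e) (Nat.mod_lt _ (pow_pos hk e))) _ hlt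
      convert this using 3 with n
      conv_lhs => rw [← Nat.div_add_mod j (k ^ e)]
      ring
  have hle : Submodule.span R (kernel k s) ≤ V :=
    Submodule.span_le.mpr fun t ⟨e, j, hj, ht⟩ => ht ▸ hker e j hj
  exact hV.of_le hle

theorem isRegularSeq_of_recurrence {A : Type*} [Fintype A] {φ : A → List A} {k : ℕ} (hk : 0 < k)
    (hφ : IsUniform φ k) {w : ℕ → A} (hw : morphImage φ w = w) (R : Subring ℝ)
    [IsNoetherianRing R] (hR : (k : ℝ)⁻¹ ∈ R) {s : ℕ → ℝ} (c : A → ℕ → ℝ)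
    (hs : ∀ n, ∀ p < k, s (k * n + p) = s n / k + c (w n) p) : IsRegularSeq R k s := by
  classical
  -- The indicated letter and the index of the constant are kept independent: decimation changes the
  -- first and keeps the second, and the constants need not lie in `R`.
  let g : A × A × Fin k → ℕ → ℝ := fun q n => if w n = q.1 then c q.2.1 q.2.2 else 0
  let V : Submodule R (ℕ → ℝ) := Submodule.span R (insert s (Set.range g))
  have hsV : s ∈ V := Submodule.subset_span (Set.mem_insert _ _)
  have hgV : ∀ q, g q ∈ V := fun q => Submodule.subset_span (Set.mem_insert_of_mem _ ⟨q, rfl⟩)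
  refine isRegularSeq_of_stable hk V
    (Submodule.fg_span ((Set.finite_range g).insert s)) hsV fun t ht p hp => ?_
  let D : (ℕ → ℝ) →ₗ[R] (ℕ → ℝ) := LinearMap.funLeft R ℝ fun n => k * n + p
  suffices h : V ≤ V.comap D from h ht
  refine Submodule.span_le.mpr ?_
  rintro f (hf | ⟨⟨a, b, q⟩, rfl⟩)
  · rw [hf]
    have : D s = (⟨(k : ℝ)⁻¹, hR⟩ : R) • s + ∑ a, g (a, a, ⟨p, hp⟩) := by
      funext n
      have h := hs n p hp
      simp only [D, g, LinearMap.funLeft_apply, Pi.add_apply, Pi.smul_apply, Subring.smul_def,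
        smul_eq_mul, Finset.sum_apply, h, Finset.sum_ite_eq, Finset.mem_univ, if_true]
      rw [div_eq_inv_mul]
    change D s ∈ V
    rw [this]
    exact V.add_mem (V.smul_mem _ hsV) (Submodule.sum_mem _ fun a _ => hgV _)
  -- Letter `k n + p` of the fixed point `w` is letter `p` of `φ (w n)`, so a decimated indicator is
  -- a sum of indicators.
  · have : D (g (a, b, q)) = ∑ a' with (φ a').getD p a' = a, g (a', b, q) := by
      funext n
      have h : w (k * n + p) = (φ (w n)).getD p (w n) := by
        conv_lhs => rw [← hw]
        exact morphImage_mul_add hφ w n hp _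
      simp only [D, g, LinearMap.funLeft_apply, Finset.sum_apply, h, Finset.sum_ite_eq,
        Finset.mem_filter, Finset.mem_univ, true_and]
    change D (g (a, b, q)) ∈ V
    rw [this]
    exact Submodule.sum_mem _ fun a' _ => hgV _

end Regular

/-- The source interval has length `μ_a` and the target `μ_a / θ`; a nonzero frequency makes the
slope `1 / θ`. -/
theorem intervalMap_eq {A : Type*} [Fintype A] [LinearOrder A] [MeasurableSpace A]
    {φ : A → List A} {μ : Measure (ℕ → A)} {r : WordType φ → WordType φ → Prop}
    {L : Set (ℕ → A)} {θ : ℝ} (t : WordType φ)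
    (h : letterFreq μ L t.1 ≠ 0) (x : ℝ) :
    intervalMap μ L φ θ r t x = x / θ + intervalConst μ L φ θ r t := by
  simp only [intervalMap, intervalConst, add_sub_cancel_left, div_right_comm _ θ, div_self h]
  ring

/-! ### The recurrence along the orbit of the fixed point -/

section Sequence

variable {A : Type*} [Fintype A] [LinearOrder A]
  [TopologicalSpace A] [DiscreteTopology A] [MeasurableSpace A] [DiscreteMeasurableSpace A]
  {φ : A → List A} {k : ℕ} {w : ℕ → A} {μ : Measure (ℕ → A)} {r : WordType φ → WordType φ → Prop}

theorem typableSystem_subshift (hk : 0 < k) (hφ : IsUniform φ k)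
    (hT : Typable φ (subshift w)) : TypableSystem φ k (subshift w) where
  pos := hk
  uniform := hφ
  typable := hT
  measurableSet := isClosed_closure.measurableSet
  mapsTo := mapsTo_shift_subshift w

theorem nuSeq_mul_add (hk : 2 ≤ k) (hφ : IsUniform φ k) (hprim : IsPrimitive φ)
    (hw : morphImage φ w = w) (hT : Typable φ (subshift w))
    (hord : OrderPreservingOn φ (subshift w)) (hμ : IsInvariantMeasureOn μ (subshift w))
    (hr : IsTypeOrder φ (subshift w) r) (n : ℕ) (p : Fin (φ (w n)).length) :
    nuSeq μ w (k * n + p) = nuSeq μ w n / k + intervalConst μ (subshift w) φ k r ⟨w n, p⟩ := by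
  have hk0 : 0 < k := by omega
  -- As `w = φ(w)`, the word `σ^(kn) w` is `φ(σ^n w)`.
  have hd : IsDesubstitution φ (subshift w) (shift^[k * n + p] w) (shift^[n] w) p := by
    refine ⟨shift_iterate_mem_subshift w n, ?_, ?_⟩
    · exact p.2.trans_eq ((hφ _).trans (hφ _).symm)
    · rw [← shift_iterate_morphImage hk0 hφ, hw, add_comm, Function.iterate_add_apply]
  have hv := shift_iterate_mem_subshift w (k * n + p)
  have h := nu_eq_nu_root_div_add (typableSystem_subshift hk0 hφ hT) hk hprim hord hr hμ hv
    (t := ⟨w n, p⟩) ⟨_, hd, by simp [shift_iterate_apply]⟩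
  rwa [(hd.eq hT hv).1] at h

theorem isRegularSeq_nuSeq (hk : 2 ≤ k) (hφ : IsUniform φ k) (hprim : IsPrimitive φ)
    (hw : morphImage φ w = w) (hT : Typable φ (subshift w))
    (hord : OrderPreservingOn φ (subshift w)) (hμ : IsInvariantMeasureOn μ (subshift w))
    (hr : IsTypeOrder φ (subshift w) r) (R : Subring ℝ) [IsNoetherianRing R]
    (hR : (k : ℝ)⁻¹ ∈ R) : IsRegularSeq R k (nuSeq μ w) := by
  refine isRegularSeq_of_recurrence (by omega) hφ hw R hR
    (fun a p => if h : p < (φ a).length then intervalConst μ (subshift w) φ k r ⟨a, p, h⟩ else 0)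
    fun n p hp => ?_
  have hp' : p < (φ (w n)).length := by rwa [hφ]
  rw [dif_pos hp']
  exact nuSeq_mul_add hk hφ hprim hw hT hord hμ hr n ⟨p, hp'⟩

end Sequence

end MorphicWord

theorem mainTheorem3 {A : Type*} [Fintype A] [LinearOrder A]
    [TopologicalSpace A] [DiscreteTopology A] [MeasurableSpace A] [DiscreteMeasurableSpace A]
    (φ : A → List A) (k : ℕ) (hk : 2 ≤ k) (huniform : MorphicWord.IsUniform φ k)
    (hprim : MorphicWord.IsPrimitive φ)
    (w : ℕ → A) (hw : MorphicWord.morphImage φ w = w)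
    (hsep : MorphicWord.Separable φ (MorphicWord.subshift w))
    (hord : MorphicWord.OrderPreservingOn φ (MorphicWord.subshift w))
    (μ : MeasureTheory.Measure (ℕ → A))
    (hμ : MorphicWord.IsInvariantMeasureOn μ (MorphicWord.subshift w)) :
    (∀ R : Subring ℝ, IsNoetherianRing R → (k : ℝ)⁻¹ ∈ R →
      MorphicWord.IsRegularSeq R k (MorphicWord.nuSeq μ w)) ∧
    (∀ θ : ℝ, MorphicWord.IsPerronEigenvalue (MorphicWord.incidenceMatrix φ) θ →
      ∀ r : MorphicWord.WordType φ → MorphicWord.WordType φ → Prop,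
        MorphicWord.IsTypeOrder φ (MorphicWord.subshift w) r →
        θ = k ∧
        (∀ (t : MorphicWord.WordType φ) (x : ℝ),
          MorphicWord.intervalMap μ (MorphicWord.subshift w) φ θ r t x =
            x / θ + MorphicWord.intervalConst μ (MorphicWord.subshift w) φ θ r t) ∧
        (∀ (n : ℕ) (p : Fin (φ (w n)).length),
          MorphicWord.nuSeq μ w (k * n + p) =
            MorphicWord.nuSeq μ w n / k +
              MorphicWord.intervalConst μ (MorphicWord.subshift w) φ θ r ⟨w n, p⟩)) := by
  obtain ⟨hT, r₀, hr₀⟩ := hsep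
  refine ⟨fun R _ hR => MorphicWord.isRegularSeq_nuSeq hk huniform hprim hw hT hord hμ hr₀ R hR,
    fun θ hθ r hr => ?_⟩
  have : Nonempty A := ⟨w 0⟩
  obtain rfl : θ = k := hθ.eq_natCast huniform
  exact ⟨rfl, fun t => MorphicWord.intervalMap_eq t (MorphicWord.letterFreq_pos
    (MorphicWord.typableSystem_subshift (by omega) huniform hT) hprim hμ t.1).ne',
    MorphicWord.nuSeq_mul_add hk huniform hprim hw hT hord hμ hr⟩
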